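/- Let $(\Omega,\mathcal F,P)$ be a probability space carrying real random variables $Y_0$, $Y_1$ with cumulative distribution functions $F_0$, $F_1$ and left-continuous quantile functions $Q_j(p)=\inf\{x\in\mathbb R: p\le F_j(x)\}$, $0<p<1$, $j=0,1$. Let $U$ be a normalized rank of $Y_0$: a random variable on $\Omega$ that is uniformly distributed on $(0,1)$ and satisfies $Y_0=Q_0(U)$ almost surely. (Nothing else is assumed about the joint distribution of $Y_0,Y_1,U$, and no moments are assumed.) Write $A\preceq_2 B$ if the distribution of $A$ is second-order stochastically dominated by that of $B$, that is, if $\int_{-\infty}^x F_B(t)\,dt\le\int_{-\infty}^x F_A(t)\,dt$ in $[0,\infty]$ for every $x\in\mathbb R$. Let $0\le a<b\le 1$. Then, conditional on $a<U<b$ (all distributions being taken under $P(\,\cdot\mid a<U<b)$), $$Q_1(b-U)-Q_0(U)\;\preceq_2\;Y_1-Y_0\;\preceq_2\;Q_1(1-b+U)-Q_0(U).$$ Moreover (equivalently), for every nondecreasing convex $f:\mathbb R\to\mathbb R$ and every nonincreasing convex $g:\mathbb R\to\mathbb R$, $$\int_a^b f(Q_1(u-a)-Q_0(u))\,du\le\mathbb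 E[f(Y_1-Y_0)\mathbf 1\{a<U<b\}]\le\int_a^b f(Q_1(1-u+a)-Q_0(u))\,du,$$ $$\int_a^b g(Q_1(1-b+u)-Q_0(u))\,du\le\mathbb E[g(Y_1-Y_0)\mathbf 1\{a<U<b\}]\le\int_a^b g(Q_1(b-u)-Q_0(u))\,du,$$ where each of the four inequalities is understood in $[-\infty,\infty]$ and asserted whenever both of its sides are well defined there (the positive or the negative part of the integrand has a finite integral). -/

import Mathlib

open MeasureTheory ProbabilityTheory Set
open scoped ENNReal

noncomputable section

/-- The left-continuous generalized inverse of the cdf `F` of the probability measure `ν` on `ℝ`,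
`Q(p) = inf {x | p ≤ F(x)}`.  It is only meaningful for `0 < p < 1`, where the infimum is over a
nonempty set that is bounded below. -/
def leftQuantile (ν : Measure ℝ) (p : ℝ) : ℝ :=
  sInf {x : ℝ | p ≤ cdf ν x}

/-- Second-order stochastic dominance under the probability measure `μ`: the distribution of `A` is
second-order stochastically dominated by that of `B`, that is,
`∫_{-∞}^x F_B(t) dt ≤ ∫_{-∞}^x F_A(t) dt` for every real `x`.  The integrands are nonnegative, so
the integrals are taken in `[0, ∞]` and no moment condition is needed. -/
def SecondOrderDominated {Ω : Type*} [MeasurableSpace Ω] (μ : Measure Ω) (A B : Ω → ℝ) : Prop :=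
  ∀ x : ℝ, ∫⁻ t in Iic x, μ {ω | B ω ≤ t} ≤ ∫⁻ t in Iic x, μ {ω | A ω ≤ t}

/-- The integral of `X` is well defined in `[-∞, ∞]`: its positive part or its negative part has a
finite integral. -/
def HasExtIntegral {Ω : Type*} [MeasurableSpace Ω] (μ : Measure Ω) (X : Ω → ℝ) : Prop :=
  ∫⁻ ω, ENNReal.ofReal (X ω) ∂μ ≠ ∞ ∨ ∫⁻ ω, ENNReal.ofReal (-X ω) ∂μ ≠ ∞

/-- The integral `∫ X⁺ dμ - ∫ X⁻ dμ ∈ [-∞, ∞]`, to be used only where `HasExtIntegral μ X`. -/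
def extIntegral {Ω : Type*} [MeasurableSpace Ω] (μ : Measure Ω) (X : Ω → ℝ) : EReal :=
  ((∫⁻ ω, ENNReal.ofReal (X ω) ∂μ : ℝ≥0∞) : EReal)
    - ((∫⁻ ω, ENNReal.ofReal (-X ω) ∂μ : ℝ≥0∞) : EReal)

/-- `∫ X dμ ≤ ∫ Y dν` in `[-∞, ∞]`, provided that both integrals are well defined there. -/
def ExtIntegralLE {Ω Ω' : Type*} [MeasurableSpace Ω] [MeasurableSpace Ω']
    (μ : Measure Ω) (X : Ω → ℝ) (ν : Measure Ω') (Y : Ω' → ℝ) : Prop :=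
  HasExtIntegral μ X → HasExtIntegral ν Y → extIntegral μ X ≤ extIntegral ν Y

end

/-! Up to constants and a limit, a nondecreasing convex function is a mixture of calls `(z - x)⁺`
and a nonincreasing one a mixture of puts `(x - z)⁺` (`extIntegralLE_of_stopLoss` and its
reflection); second-order dominance is a comparison of all puts. So it suffices to bound calls and
puts of `Y₁ - Y₀` under `κ`, the restriction of `P` to `a < U < b`.

Since `(x - (A - B))⁺` is the length of `[A, x + B)`, Tonelli turns a put into `∫ κ(A ≤ t, t - x <
B) dt` (`lintegral_ofReal_sub_sub`), and only joint probabilities at each `t` matter. There `{Y₀ >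
s}` is almost surely `{U > F₀(s)}`, and all that is used of `Y₁` is `κ(Y₁ ≤ t) ≤ F₁(t)` and `κ(Y₁ >
t) ≤ 1 - F₁(t)`. The resulting Fréchet bounds are attained, for all `t` at once, when `{Y₁ ≤ t}` is
replaced by an interval of ranks at one end of `(a, b)`; these intervals are the sublevel sets of
the four quantile expressions. -/

/-! ### Convex monotone functions as mixtures of calls. -/

theorem volume_inter_Iic_of_isUpperSet {W : Set ℝ} (hW : IsUpperSet W) (hne : W.Nonempty)
    (hbdd : BddBelow W) (z : ℝ) : volume (W ∩ Iic z) = ENNReal.ofReal (z - sInf W) := by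
  apply le_antisymm
  · rw [← Real.volume_Icc]
    exact measure_mono fun t ht => ⟨csInf_le hbdd ht.1, ht.2⟩
  · rw [← Real.volume_Ioc]
    refine measure_mono fun t ht => ⟨?_, ht.2⟩
    obtain ⟨w, hw, hwt⟩ := exists_lt_of_csInf_lt hne ht.1
    exact hW hwt.le hw

theorem ConvexOn.ofReal_max_sub_eq_setLIntegral {f : ℝ → ℝ} (hmono : Monotone f)
    (hconv : ConvexOn ℝ univ f) (x z : ℝ) :
    ENNReal.ofReal (f (max z x) - f x)
      = ∫⁻ t in Ioc x z, ENNReal.ofReal (derivWithin f (Ioi t) t) := by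
  rcases le_or_gt z x with h | h
  · simp [max_eq_right h, Ioc_eq_empty (not_lt.2 h)]
  · have hcont : Continuous f := by
      rw [← continuousOn_univ]; exact hconv.continuousOn isOpen_univ
    have hm : Monotone fun t => derivWithin f (Ioi t) t := by
      have := hconv.monotoneOn_rightDeriv
      rwa [interior_univ, monotoneOn_univ] at this
    have hint : IntervalIntegrable (fun t => derivWithin f (Ioi t) t) volume x z :=
      hm.intervalIntegrable
    have key := intervalIntegral.integral_eq_sub_of_hasDeriv_right_of_le h.le hcont.continuousOn
      (fun t _ => hconv.hasDerivWithinAt_rightDeriv_of_mem_interior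
        (by rw [interior_univ]; trivial)) hint
    rw [max_eq_left h.le, ← key, intervalIntegral.integral_of_le h.le,
      ofReal_integral_eq_lintegral_ofReal
        ((intervalIntegrable_iff_integrableOn_Ioc_of_le h.le).1 hint)]
    exact Filter.Eventually.of_forall fun t => (hmono.monotoneOn _).derivWithin_nonneg

/-- Layer-cake form of the integral of the right derivative. Slicing by slope `s` avoids the
Stieltjes measure of the derivative. -/
theorem ConvexOn.ofReal_max_sub_eq_lintegral_volume {f : ℝ → ℝ} (hmono : Monotone f)
    (hconv : ConvexOn ℝ univ f) (x z : ℝ) :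
    ENNReal.ofReal (f (max z x) - f x)
      = ∫⁻ s in Ici 0, volume ({t | x < t ∧ s < derivWithin f (Ioi t) t} ∩ Iic z) := by
  have hm : Monotone fun t => derivWithin f (Ioi t) t := by
    have := hconv.monotoneOn_rightDeriv
    rwa [interior_univ, monotoneOn_univ] at this
  have hmeas := hm.measurable
  have hD : MeasurableSet {p : ℝ × ℝ | p.2 < derivWithin f (Ioi p.1) p.1} :=
    measurableSet_lt measurable_snd (hmeas.comp measurable_fst)
  have hD' : ∀ s, MeasurableSet {t : ℝ | s < derivWithin f (Ioi t) t} := fun s =>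
    measurableSet_lt measurable_const hmeas
  rw [hconv.ofReal_max_sub_eq_setLIntegral hmono]
  calc ∫⁻ t in Ioc x z, ENNReal.ofReal (derivWithin f (Ioi t) t)
      = ∫⁻ t in Ioc x z, ∫⁻ s in Ici 0,
          {p : ℝ × ℝ | p.2 < derivWithin f (Ioi p.1) p.1}.indicator 1 (t, s) := by
        refine lintegral_congr fun t => ?_
        have : ∀ s, {p : ℝ × ℝ | p.2 < derivWithin f (Ioi p.1) p.1}.indicator
            (1 : ℝ × ℝ → ℝ≥0∞) (t, s) = (Iio (derivWithin f (Ioi t) t)).indicator 1 s :=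
          fun s => by simp [indicator]
        simp_rw [this]
        rw [lintegral_indicator_one measurableSet_Iio, Measure.restrict_apply measurableSet_Iio,
          inter_comm,
          Ici_inter_Iio, Real.volume_Ico, sub_zero]
    _ = ∫⁻ s in Ici 0, ∫⁻ t in Ioc x z,
          {p : ℝ × ℝ | p.2 < derivWithin f (Ioi p.1) p.1}.indicator 1 (t, s) :=
        lintegral_lintegral_swap (measurable_one.indicator hD).aemeasurable
    _ = _ := by
        refine lintegral_congr fun s => ?_
        have : ∀ t, {p : ℝ × ℝ | p.2 < derivWithin f (Ioi p.1) p.1}.indicator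
            (1 : ℝ × ℝ → ℝ≥0∞) (t, s) = {t | s < derivWithin f (Ioi t) t}.indicator 1 t :=
          fun t => by simp [indicator]
        simp_rw [this]
        rw [lintegral_indicator_one (hD' s), Measure.restrict_apply (hD' s)]
        congr 1
        ext t
        simp only [mem_inter_iff, mem_ofPred_eq, mem_Ioc, mem_Iic]
        tauto

theorem lintegral_ofReal_max_sub_le_of_stopLoss {μ ν : Measure ℝ} [SFinite μ] [SFinite ν]
    (h : ∀ x : ℝ, ∫⁻ z, ENNReal.ofReal (z - x) ∂μ ≤ ∫⁻ z, ENNReal.ofReal (z - x) ∂ν)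
    {f : ℝ → ℝ} (hmono : Monotone f) (hconv : ConvexOn ℝ univ f) (x : ℝ) :
    ∫⁻ z, ENNReal.ofReal (f (max z x) - f x) ∂μ
      ≤ ∫⁻ z, ENNReal.ofReal (f (max z x) - f x) ∂ν := by
  have hm : Monotone fun t => derivWithin f (Ioi t) t := by
    have := hconv.monotoneOn_rightDeriv
    rwa [interior_univ, monotoneOn_univ] at this
  have hmeas := hm.measurable
  set W : ℝ → Set ℝ := fun s => {t | x < t ∧ s < derivWithin f (Ioi t) t} with hWdef
  have hG : MeasurableSet {p : (ℝ × ℝ) × ℝ | p.2 ∈ W p.1.2 ∩ Iic p.1.1} :=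
    ((measurableSet_lt measurable_const measurable_snd).inter
      (measurableSet_lt (measurable_snd.comp measurable_fst) (hmeas.comp measurable_snd))).inter
      (measurableSet_le measurable_snd (measurable_fst.comp measurable_fst))
  have hvol : Measurable fun p : ℝ × ℝ => volume (W p.2 ∩ Iic p.1) :=
    measurable_measure_prodMk_left hG
  have hswap : ∀ (ρ : Measure ℝ) [SFinite ρ],
      ∫⁻ z, ENNReal.ofReal (f (max z x) - f x) ∂ρ
        = ∫⁻ s in Ici 0, ∫⁻ z, volume (W s ∩ Iic z) ∂ρ := fun ρ _ => by
    simp_rw [hconv.ofReal_max_sub_eq_lintegral_volume hmono]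
    exact lintegral_lintegral_swap hvol.aemeasurable
  rw [hswap μ, hswap ν]
  refine lintegral_mono fun s => ?_
  -- The right derivative is monotone, so a nonempty `W s` is a half-line and its slice is a call
  -- with strike `sInf (W s)`.
  rcases (W s).eq_empty_or_nonempty with hs | hs
  · simp [hs]
  · have hup : IsUpperSet (W s) := fun t t' htt' ht =>
      ⟨ht.1.trans_le htt', ht.2.trans_le (hm htt')⟩
    have hbdd : BddBelow (W s) := ⟨x, fun t ht => ht.1.le⟩
    simp_rw [volume_inter_Iic_of_isUpperSet hup hs hbdd]
    exact h _

/-! ### From calls and puts to integrals in `[-∞, ∞]`. -/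

theorem extIntegral_eq_integral {Ω : Type*} [MeasurableSpace Ω] {μ : Measure Ω} {X : Ω → ℝ}
    (hX : Integrable X μ) : extIntegral μ X = ((∫ ω, X ω ∂μ : ℝ) : EReal) := by
  have h1 : ∫⁻ ω, ENNReal.ofReal (X ω) ∂μ ≠ ∞ :=
    (hX.lintegral_lt_top).ne
  have h2 : ∫⁻ ω, ENNReal.ofReal (-X ω) ∂μ ≠ ∞ := hX.neg.lintegral_lt_top.ne
  rw [integral_eq_lintegral_pos_part_sub_lintegral_neg_part hX, extIntegral, EReal.coe_sub,
    EReal.coe_ennreal_toReal h1, EReal.coe_ennreal_toReal h2]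

theorem integrable_of_lintegral_ofReal_ne_top {Ω : Type*} [MeasurableSpace Ω] {μ : Measure Ω}
    {X : Ω → ℝ} (hX : AEMeasurable X μ) (h1 : ∫⁻ ω, ENNReal.ofReal (X ω) ∂μ ≠ ∞)
    (h2 : ∫⁻ ω, ENNReal.ofReal (-X ω) ∂μ ≠ ∞) : Integrable X μ := by
  have hp : Integrable (fun ω => max (X ω) 0) μ := by
    refine (lintegral_ofReal_ne_top_iff_integrable (f := fun ω => max (X ω) 0)
      (hX.max aemeasurable_const).aestronglyMeasurable
      (Filter.Eventually.of_forall fun _ => le_max_right _ _)).1 ?_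
    simpa [ENNReal.ofReal_max] using h1
  have hn : Integrable (fun ω => max (-X ω) 0) μ := by
    refine (lintegral_ofReal_ne_top_iff_integrable (f := fun ω => max (-X ω) 0)
      (hX.neg.max aemeasurable_const).aestronglyMeasurable
      (Filter.Eventually.of_forall fun _ => le_max_right _ _)).1 ?_
    simpa [ENNReal.ofReal_max] using h2
  refine (hp.sub hn).congr (Filter.Eventually.of_forall fun ω => ?_)
  simp only [Pi.sub_apply]
  rcases le_total (X ω) 0 with h | h
  · rw [max_eq_right h, max_eq_left (by linarith)]; ring
  · rw [max_eq_left h, max_eq_right (by linarith)]; ring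

/-- The truncations `f (max z x)` are bounded below, so calls compare their integrals, equal masses
cancelling the constant `f x`. The truncation is then removed by letting `x → -∞`, infinite values
being treated separately. -/
theorem extIntegralLE_of_stopLoss {μ ν : Measure ℝ} [IsFiniteMeasure μ] [IsFiniteMeasure ν]
    (hmass : μ univ = ν univ)
    (h : ∀ x : ℝ, ∫⁻ z, ENNReal.ofReal (z - x) ∂μ ≤ ∫⁻ z, ENNReal.ofReal (z - x) ∂ν)
    {f : ℝ → ℝ} (hmono : Monotone f) (hconv : ConvexOn ℝ univ f) :
    ExtIntegralLE μ f ν f := by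
  intro _ hν
  have hcont : Continuous f := by
    rw [← continuousOn_univ]; exact hconv.continuousOn isOpen_univ
  by_cases hpos : ∫⁻ z, ENNReal.ofReal (f z) ∂ν = ∞
  · have hneg := hν.resolve_left (not_not.2 hpos)
    have : extIntegral ν f = ⊤ := by
      rw [extIntegral, hpos, EReal.coe_ennreal_top]
      exact EReal.top_sub (by simpa using hneg)
    rw [this]; exact le_top
  have hposint : Integrable (fun z => max (f z) 0) ν := by
    refine (lintegral_ofReal_ne_top_iff_integrable (f := fun z => max (f z) 0)
      (hcont.max continuous_const).aestronglyMeasurable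
      (Filter.Eventually.of_forall fun _ => le_max_right _ _)).1 ?_
    simpa [ENNReal.ofReal_max] using hpos
  have hφcont : ∀ x, Continuous fun z => f (max z x) := fun x => by fun_prop
  have hφν : ∀ x, Integrable (fun z => f (max z x)) ν := fun x => by
    refine (hposint.add (integrable_const |f x|)).mono' (hφcont x).aestronglyMeasurable
      (Filter.Eventually.of_forall fun z => ?_)
    simp only [Real.norm_eq_abs, Pi.add_apply]
    have h1 := hmono (le_max_right z x)
    have h2 := abs_nonneg (f x)
    have h3 := neg_abs_le (f x)
    have h4 := le_abs_self (f x)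
    have h5 := le_max_left (f z) 0
    have h6 := le_max_right (f z) 0
    rcases le_total z x with hz | hz
    · rw [max_eq_right hz]; linarith
    · rw [max_eq_left hz] at h1 ⊢
      rw [abs_le]; constructor <;> linarith
  have hnn : ∀ x z, 0 ≤ f (max z x) - f x := fun x z =>
    sub_nonneg.2 (hmono (le_max_right z x))
  have hcall := fun x => lintegral_ofReal_max_sub_le_of_stopLoss h hmono hconv x
  have hνint : ∀ x, Integrable (fun z => f (max z x) - f x) ν := fun x =>
    (hφν x).sub (integrable_const _)
  have hμint : ∀ x, Integrable (fun z => f (max z x) - f x) μ := fun x => by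
    refine (lintegral_ofReal_ne_top_iff_integrable
      ((hφcont x).sub continuous_const).aestronglyMeasurable
      (Filter.Eventually.of_forall (hnn x))).1 ?_
    exact ((hcall x).trans_lt (hνint x).lintegral_lt_top).ne
  have hφμ : ∀ x, Integrable (fun z => f (max z x)) μ := fun x => by
    refine ((hμint x).add (integrable_const (f x))).congr (Filter.Eventually.of_forall fun z => ?_)
    simp
  have hle : ∀ x, ∫ z, f (max z x) ∂μ ≤ ∫ z, f (max z x) ∂ν := fun x => by
    have h1 : ∫ z, (f (max z x) - f x) ∂μ ≤ ∫ z, (f (max z x) - f x) ∂ν := by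
      rw [integral_eq_lintegral_of_nonneg_ae (Filter.Eventually.of_forall (hnn x))
        (hμint x).aestronglyMeasurable,
        integral_eq_lintegral_of_nonneg_ae (Filter.Eventually.of_forall (hnn x))
        (hνint x).aestronglyMeasurable]
      exact ENNReal.toReal_mono (hνint x).lintegral_lt_top.ne (hcall x)
    rw [integral_sub (hφμ x) (integrable_const _), integral_sub (hφν x) (integrable_const _),
      integral_const, integral_const, measureReal_def, measureReal_def, hmass] at h1
    linarith
  have hμpos : ∫⁻ z, ENNReal.ofReal (f z) ∂μ ≠ ∞ :=
    ((lintegral_mono fun z => ENNReal.ofReal_le_ofReal (hmono (le_max_left z 0))).trans_lt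
      (hφμ 0).lintegral_lt_top).ne
  by_cases hneg : ∫⁻ z, ENNReal.ofReal (-f z) ∂μ = ∞
  · have : extIntegral μ f = ⊥ := by
      rw [extIntegral, hneg, EReal.coe_ennreal_top]
      exact EReal.sub_top _
    rw [this]; exact bot_le
  have hfμ : Integrable f μ :=
    integrable_of_lintegral_ofReal_ne_top hcont.measurable.aemeasurable hμpos hneg
  have hc : ∀ x, ∫ z, f z ∂μ ≤ ∫ z, f (max z x) ∂ν := fun x =>
    (integral_mono hfμ (hφμ x) fun z => hmono (le_max_left z x)).trans (hle x)
  -- A bound uniform in `n`: monotone convergence then yields both the integrability of `f` under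
  -- `ν` and the inequality itself.
  have hψ : ∀ n : ℕ, ∫⁻ z, ENNReal.ofReal (f (max z 0) - f (max z (-n))) ∂ν
      ≤ ENNReal.ofReal (∫ z, f (max z 0) ∂ν - ∫ z, f z ∂μ) := fun n => by
    have hint : Integrable (fun z => f (max z 0) - f (max z (-n))) ν := (hφν 0).sub (hφν _)
    rw [← ofReal_integral_eq_lintegral_ofReal hint
      (Filter.Eventually.of_forall fun z => sub_nonneg.2 (hmono (max_le_max le_rfl (by simp)))),
      integral_sub (hφν 0) (hφν _)]
    exact ENNReal.ofReal_le_ofReal (by linarith [hc (-n)])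
  have hlim : Filter.Tendsto
      (fun n : ℕ => ∫⁻ z, ENNReal.ofReal (f (max z 0) - f (max z (-n))) ∂ν) Filter.atTop
      (nhds (∫⁻ z, ENNReal.ofReal (f (max z 0) - f z) ∂ν)) := by
    refine lintegral_tendsto_of_tendsto_of_monotone
      (fun n => ((hφcont 0).sub (hφcont _)).measurable.ennreal_ofReal.aemeasurable)
      (Filter.Eventually.of_forall fun z => ?_) (Filter.Eventually.of_forall fun z => ?_)
    · intro m n hmn
      have : (m : ℝ) ≤ n := by exact_mod_cast hmn
      exact ENNReal.ofReal_le_ofReal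
        (sub_le_sub_left (hmono (max_le_max le_rfl (neg_le_neg this))) _)
    · obtain ⟨N, hN⟩ := exists_nat_ge (-z)
      refine tendsto_const_nhds.congr' ?_
      filter_upwards [Filter.eventually_ge_atTop N] with n hn
      have : (N : ℝ) ≤ n := by exact_mod_cast hn
      rw [max_eq_left (show -(n : ℝ) ≤ z by linarith)]
  have hlimle := le_of_tendsto' hlim hψ
  have hnn' : ∀ z, 0 ≤ f (max z 0) - f z := fun z => sub_nonneg.2 (hmono (le_max_left z 0))
  have hdint : Integrable (fun z => f (max z 0) - f z) ν := by
    refine (lintegral_ofReal_ne_top_iff_integrable ((hφcont 0).sub hcont).aestronglyMeasurable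
      (Filter.Eventually.of_forall hnn')).1 ?_
    exact (hlimle.trans_lt ENNReal.ofReal_lt_top).ne
  have hfν : Integrable f ν := by
    refine ((hφν 0).sub hdint).congr (Filter.Eventually.of_forall fun z => ?_)
    simp
  rw [extIntegral_eq_integral hfμ, extIntegral_eq_integral hfν, EReal.coe_le_coe_iff]
  rw [← ofReal_integral_eq_lintegral_ofReal hdint (Filter.Eventually.of_forall hnn'),
    ENNReal.ofReal_le_ofReal_iff (by linarith [hc 0]), integral_sub (hφν 0) hfν] at hlimle
  linarith

theorem ExtIntegralLE.of_stopLoss {Ω Ω' : Type*} [MeasurableSpace Ω] [MeasurableSpace Ω']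
    {μ : Measure Ω} {ν : Measure Ω'} [IsFiniteMeasure μ] [IsFiniteMeasure ν]
    {X : Ω → ℝ} {Y : Ω' → ℝ} (hX : AEMeasurable X μ) (hY : AEMeasurable Y ν)
    (hmass : μ univ = ν univ)
    (h : ∀ x : ℝ, ∫⁻ ω, ENNReal.ofReal (X ω - x) ∂μ ≤ ∫⁻ ω, ENNReal.ofReal (Y ω - x) ∂ν)
    {f : ℝ → ℝ} (hmono : Monotone f) (hconv : ConvexOn ℝ univ f) :
    ExtIntegralLE μ (fun ω => f (X ω)) ν (fun ω => f (Y ω)) := by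
  have hm : Measurable f := hmono.measurable
  have hm1 : Measurable fun z => ENNReal.ofReal (f z) := hm.ennreal_ofReal
  have hm2 : Measurable fun z => ENNReal.ofReal (-f z) := hm.neg.ennreal_ofReal
  have hm3 : ∀ x : ℝ, Measurable fun z : ℝ => ENNReal.ofReal (z - x) := fun x => by fun_prop
  have key : ExtIntegralLE (μ.map X) f (ν.map Y) f := by
    refine extIntegralLE_of_stopLoss ?_ (fun x => ?_) hmono hconv
    · rw [Measure.map_apply_of_aemeasurable hX MeasurableSet.univ,
        Measure.map_apply_of_aemeasurable hY MeasurableSet.univ]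
      simpa using hmass
    · rw [lintegral_map' (hm3 x).aemeasurable hX, lintegral_map' (hm3 x).aemeasurable hY]
      exact h x
  simpa only [ExtIntegralLE, HasExtIntegral, extIntegral,
    lintegral_map' hm1.aemeasurable hX, lintegral_map' hm1.aemeasurable hY,
    lintegral_map' hm2.aemeasurable hX, lintegral_map' hm2.aemeasurable hY] using key

theorem ExtIntegralLE.of_stopLoss_antitone {Ω Ω' : Type*} [MeasurableSpace Ω] [MeasurableSpace Ω']
    {μ : Measure Ω} {ν : Measure Ω'} [IsFiniteMeasure μ] [IsFiniteMeasure ν]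
    {X : Ω → ℝ} {Y : Ω' → ℝ} (hX : AEMeasurable X μ) (hY : AEMeasurable Y ν)
    (hmass : μ univ = ν univ)
    (h : ∀ x : ℝ, ∫⁻ ω, ENNReal.ofReal (x - X ω) ∂μ ≤ ∫⁻ ω, ENNReal.ofReal (x - Y ω) ∂ν)
    {g : ℝ → ℝ} (hanti : Antitone g) (hconv : ConvexOn ℝ univ g) :
    ExtIntegralLE μ (fun ω => g (X ω)) ν (fun ω => g (Y ω)) := by
  -- Reflection `z ↦ -z` exchanges puts and calls.
  have hc : ConvexOn ℝ univ fun z => g (-z) :=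
    hconv.comp_linearMap (-LinearMap.id)
  have hm : Monotone fun z => g (-z) := fun y z hyz => hanti (neg_le_neg hyz)
  simpa using ExtIntegralLE.of_stopLoss hX.neg hY.neg hmass (fun x => by
    have := h (-x)
    simpa only [Pi.neg_apply, neg_sub_left, sub_eq_add_neg, add_comm] using this) hm hc

/-! ### Indicators as restrictions of the measure. -/

theorem lintegral_ofReal_indicator {Ω : Type*} [MeasurableSpace Ω] {μ : Measure Ω} {C : Set Ω}
    (hC : MeasurableSet C) (X : Ω → ℝ) :
    ∫⁻ ω, ENNReal.ofReal (C.indicator X ω) ∂μ = ∫⁻ ω in C, ENNReal.ofReal (X ω) ∂μ := by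
  rw [← lintegral_indicator hC]
  refine lintegral_congr fun ω => ?_
  by_cases h : ω ∈ C <;> simp [h]

theorem lintegral_ofReal_neg_indicator {Ω : Type*} [MeasurableSpace Ω] {μ : Measure Ω} {C : Set Ω}
    (hC : MeasurableSet C) (X : Ω → ℝ) :
    ∫⁻ ω, ENNReal.ofReal (-C.indicator X ω) ∂μ = ∫⁻ ω in C, ENNReal.ofReal (-X ω) ∂μ := by
  rw [← lintegral_indicator hC]
  refine lintegral_congr fun ω => ?_
  by_cases h : ω ∈ C <;> simp [h]

theorem hasExtIntegral_indicator {Ω : Type*} [MeasurableSpace Ω] {μ : Measure Ω} {C : Set Ω}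
    (hC : MeasurableSet C) (X : Ω → ℝ) :
    HasExtIntegral μ (C.indicator X) ↔ HasExtIntegral (μ.restrict C) X := by
  simp only [HasExtIntegral, lintegral_ofReal_indicator hC, lintegral_ofReal_neg_indicator hC]

theorem extIntegral_indicator {Ω : Type*} [MeasurableSpace Ω] {μ : Measure Ω} {C : Set Ω}
    (hC : MeasurableSet C) (X : Ω → ℝ) :
    extIntegral μ (C.indicator X) = extIntegral (μ.restrict C) X := by
  simp only [extIntegral, lintegral_ofReal_indicator hC, lintegral_ofReal_neg_indicator hC]

/-! ### Puts as integrals of joint probabilities. -/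

theorem lintegral_ofReal_sub_sub_eq_lintegral_prod (π : Measure (ℝ × ℝ)) [SFinite π] (x : ℝ) :
    ∫⁻ p, ENNReal.ofReal (x - (p.1 - p.2)) ∂π = ∫⁻ t, π {p | p.1 ≤ t ∧ t - x < p.2} := by
  have hG : MeasurableSet {q : (ℝ × ℝ) × ℝ | q.1.1 ≤ q.2 ∧ q.2 - x < q.1.2} :=
    (measurableSet_le measurable_fst.fst measurable_snd).inter
      (measurableSet_lt (measurable_snd.sub_const x) measurable_fst.snd)
  have h1 := Measure.prod_apply (μ := π) (ν := volume) hG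
  rw [Measure.prod_apply_symm hG] at h1
  refine Eq.trans (lintegral_congr fun p => ?_) h1.symm
  have : Prod.mk p ⁻¹' {q : (ℝ × ℝ) × ℝ | q.1.1 ≤ q.2 ∧ q.2 - x < q.1.2}
      = Ico p.1 (x + p.2) := by
    ext t
    simp only [mem_preimage, mem_ofPred_eq, mem_Ico, sub_lt_iff_lt_add']
  rw [this, Real.volume_Ico]
  congr 1
  ring

theorem lintegral_ofReal_sub_sub {Ω : Type*} [MeasurableSpace Ω] {μ : Measure Ω}
    [IsFiniteMeasure μ] {A B : Ω → ℝ} (hA : AEMeasurable A μ) (hB : AEMeasurable B μ) (x : ℝ) :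
    ∫⁻ ω, ENNReal.ofReal (x - (A ω - B ω)) ∂μ = ∫⁻ t, μ {ω | A ω ≤ t ∧ t - x < B ω} := by
  have hm : Measurable fun p : ℝ × ℝ => ENNReal.ofReal (x - (p.1 - p.2)) := by fun_prop
  have h := lintegral_ofReal_sub_sub_eq_lintegral_prod (μ.map fun ω => (A ω, B ω)) x
  rw [lintegral_map' hm.aemeasurable (hA.prodMk hB)] at h
  refine h.trans (lintegral_congr fun t => ?_)
  have hS : MeasurableSet {p : ℝ × ℝ | p.1 ≤ t ∧ t - x < p.2} :=
    (measurableSet_le measurable_fst measurable_const).inter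
      (measurableSet_lt measurable_const measurable_snd)
  rw [Measure.map_apply_of_aemeasurable (hA.prodMk hB) hS]
  rfl

theorem setLIntegral_Iic_measure_le {Ω : Type*} [MeasurableSpace Ω] {μ : Measure Ω}
    [IsFiniteMeasure μ] {X : Ω → ℝ} (hX : AEMeasurable X μ) (x : ℝ) :
    ∫⁻ t in Iic x, μ {ω | X ω ≤ t} = ∫⁻ ω, ENNReal.ofReal (x - X ω) ∂μ := by
  -- With `B = 0` the second condition is `t < x`, which cuts the integral to `Iio x`.
  have h := lintegral_ofReal_sub_sub hX (aemeasurable_const (b := (0 : ℝ))) x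
  simp only [sub_zero] at h
  rw [h, ← Measure.restrict_congr_set Iio_ae_eq_Iic, ← lintegral_indicator measurableSet_Iio]
  refine lintegral_congr fun t => ?_
  by_cases ht : t < x
  · simp [ht]
  · simp [ht]

/-- The factor `c` serves for the normalization `(P C)⁻¹` in the conditional measure. -/
theorem SecondOrderDominated.of_stopLoss {Ω : Type*} [MeasurableSpace Ω] {μ : Measure Ω}
    [IsFiniteMeasure μ] {A B : Ω → ℝ} (hA : AEMeasurable A μ) (hB : AEMeasurable B μ) {c : ℝ≥0∞}
    (hc : c ≠ ∞)
    (h : ∀ x : ℝ, ∫⁻ ω, ENNReal.ofReal (x - B ω) ∂μ ≤ ∫⁻ ω, ENNReal.ofReal (x - A ω) ∂μ) :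
    SecondOrderDominated (c • μ) A B := by
  intro x
  simp only [Measure.smul_apply, smul_eq_mul]
  rw [lintegral_const_mul' _ _ hc, lintegral_const_mul' _ _ hc, setLIntegral_Iic_measure_le hA,
    setLIntegral_Iic_measure_le hB]
  exact mul_le_mul_right (h x) c

/-! ### Quantile functions. -/

/-- Right continuity of the cdf puts the infimum in the set that defines it. -/
theorem leftQuantile_le_iff (ν : Measure ℝ) {p : ℝ} (hp : p ∈ Ioo (0 : ℝ) 1) {x : ℝ} :
    leftQuantile ν p ≤ x ↔ p ≤ cdf ν x := by
  have hbdd : BddBelow {x : ℝ | p ≤ cdf ν x} := by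
    obtain ⟨m, hm⟩ := ((tendsto_cdf_atBot ν).eventually (gt_mem_nhds hp.1)).exists
    exact ⟨m, fun y hy => le_of_lt <| lt_of_not_ge fun h =>
      (hm.trans_le hy).not_ge (monotone_cdf ν h)⟩
  have hne : {x : ℝ | p ≤ cdf ν x}.Nonempty := by
    obtain ⟨m, hm⟩ := ((tendsto_cdf_atTop ν).eventually (lt_mem_nhds hp.2)).exists
    exact ⟨m, hm.le⟩
  refine ⟨fun h => ?_, fun h => csInf_le hbdd h⟩
  have hr : Filter.Tendsto (cdf ν) (nhdsWithin x (Ioi x)) (nhds (cdf ν x)) :=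
    ((cdf ν).right_continuous x).mono_left (nhdsWithin_mono _ Ioi_subset_Ici_self)
  refine ge_of_tendsto hr ?_
  filter_upwards [self_mem_nhdsWithin] with y hy
  obtain ⟨w, hw, hwy⟩ := exists_lt_of_csInf_lt hne (h.trans_lt hy)
  exact le_trans hw (monotone_cdf ν hwy.le)

theorem monotoneOn_leftQuantile (ν : Measure ℝ) : MonotoneOn (leftQuantile ν) (Ioo 0 1) :=
  fun _ hp _ hq hpq =>
    (leftQuantile_le_iff ν hp).2 (hpq.trans ((leftQuantile_le_iff ν hq).1 le_rfl))

/-! ### Fréchet bounds attained by intervals of ranks. -/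

section Rearrangement

variable {Ω : Type*} [MeasurableSpace Ω] {κ : Measure Ω} {U : Ω → ℝ} {a b : ℝ}

/-- The intersection has mass at most the smaller of the two masses, with equality for nested sets;
top intervals of ranks are nested. -/
theorem measure_inter_preimage_Ioi_le (hU : Measurable U)
    (hκ : κ.map U = volume.restrict (Ioo a b)) {E : Set Ω} {e : ℝ}
    (hE : κ E ≤ ENNReal.ofReal e) (q : ℝ) :
    κ (E ∩ U ⁻¹' Ioi q) ≤ volume.restrict (Ioo a b) (Ici (b - e) ∩ Ioi q) := by
  have h1 : κ (U ⁻¹' Ioi q) ≤ ENNReal.ofReal (b - max a q) := by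
    rw [← Measure.map_apply hU measurableSet_Ioi, hκ, Measure.restrict_apply measurableSet_Ioi,
      ← Real.volume_Ioo]
    exact measure_mono fun t ht => ⟨max_lt ht.2.1 ht.1, ht.2.2⟩
  calc κ (E ∩ U ⁻¹' Ioi q)
      ≤ min (ENNReal.ofReal e) (ENNReal.ofReal (b - max a q)) :=
        le_min ((measure_mono inter_subset_left).trans hE)
          ((measure_mono inter_subset_right).trans h1)
    _ = volume (Ioo (max (b - e) (max a q)) b) := by
        generalize max a q = m
        rw [Real.volume_Ioo, ← ENNReal.ofReal_min, ← min_sub_sub_left, sub_sub_cancel]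
    _ ≤ _ := by
        rw [Measure.restrict_apply (measurableSet_Ici.inter measurableSet_Ioi)]
        refine measure_mono fun t ht => ?_
        simp only [mem_Ioo, max_lt_iff] at ht
        exact ⟨⟨ht.1.1.le, ht.1.2.2⟩, ht.1.2.1, ht.2⟩

theorem measure_inter_preimage_Iic_le (hU : Measurable U)
    (hκ : κ.map U = volume.restrict (Ioo a b)) {E : Set Ω} {e : ℝ}
    (hE : κ E ≤ ENNReal.ofReal e) (q : ℝ) :
    κ (E ∩ U ⁻¹' Iic q) ≤ volume.restrict (Ioo a b) (Iio (a + e) ∩ Iic q) := by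
  have h1 : κ (U ⁻¹' Iic q) ≤ ENNReal.ofReal (min b q - a) := by
    rw [← Measure.map_apply hU measurableSet_Iic, hκ, Measure.restrict_apply measurableSet_Iic,
      ← Real.volume_Ioc]
    exact measure_mono fun t ht => ⟨ht.2.1, le_min ht.2.2.le ht.1⟩
  calc κ (E ∩ U ⁻¹' Iic q)
      ≤ min (ENNReal.ofReal e) (ENNReal.ofReal (min b q - a)) :=
        le_min ((measure_mono inter_subset_left).trans hE)
          ((measure_mono inter_subset_right).trans h1)
    _ = volume (Ioo a (min (a + e) (min b q))) := by
        generalize min b q = m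
        rw [Real.volume_Ioo, ← ENNReal.ofReal_min, ← min_sub_sub_right, add_sub_cancel_left]
    _ ≤ _ := by
        rw [Measure.restrict_apply (measurableSet_Iio.inter measurableSet_Iic)]
        refine measure_mono fun t ht => ?_
        simp only [mem_Ioo, lt_min_iff] at ht
        exact ⟨⟨ht.2.1, ht.2.2.2.le⟩, ht.1, ht.2.2.1⟩

/-- The intersection loses at most the mass of `Eᶜ`. The loss is largest when `Eᶜ` occupies the top
ranks, that is, when `E` is a bottom interval. -/
theorem le_measure_inter_preimage_Ioi (hU : Measurable U)
    (hκ : κ.map U = volume.restrict (Ioo a b)) {E : Set Ω} {e : ℝ} (he : 0 ≤ e)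
    (hE : κ Eᶜ ≤ ENNReal.ofReal e) (q : ℝ) :
    volume.restrict (Ioo a b) (Iic (b - e) ∩ Ioi q) ≤ κ (E ∩ U ⁻¹' Ioi q) := by
  have h1 : ENNReal.ofReal (b - max a q) ≤ κ (U ⁻¹' Ioi q) := by
    rw [← Measure.map_apply hU measurableSet_Ioi, hκ, Measure.restrict_apply measurableSet_Ioi,
      ← Real.volume_Ioo]
    refine measure_mono fun t ht => ?_
    simp only [mem_Ioo, max_lt_iff] at ht
    exact ⟨ht.1.2, ht.1.1, ht.2⟩
  have h2 : κ (U ⁻¹' Ioi q) ≤ κ (E ∩ U ⁻¹' Ioi q) + κ Eᶜ :=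
    (measure_mono fun ω hω => by
      by_cases h : ω ∈ E
      · exact Or.inl ⟨h, hω⟩
      · exact Or.inr h).trans (measure_union_le _ _)
  calc volume.restrict (Ioo a b) (Iic (b - e) ∩ Ioi q)
      ≤ volume (Ioc (max a q) (b - e)) := by
        rw [Measure.restrict_apply (measurableSet_Iic.inter measurableSet_Ioi)]
        exact measure_mono fun t ht => ⟨max_lt ht.2.1 ht.1.2, ht.1.1⟩
    _ = ENNReal.ofReal (b - max a q) - ENNReal.ofReal e := by
        rw [Real.volume_Ioc, ← ENNReal.ofReal_sub _ he]
        congr 1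
        ring
    _ ≤ _ := tsub_le_iff_right.2 (h1.trans (h2.trans (by gcongr)))

theorem le_measure_inter_preimage_Iic (hU : Measurable U)
    (hκ : κ.map U = volume.restrict (Ioo a b)) {E : Set Ω} {e : ℝ} (he : 0 ≤ e)
    (hE : κ Eᶜ ≤ ENNReal.ofReal e) (q : ℝ) :
    volume.restrict (Ioo a b) (Ioi (a + e) ∩ Iic q) ≤ κ (E ∩ U ⁻¹' Iic q) := by
  have h1 : ENNReal.ofReal (min b q - a) ≤ κ (U ⁻¹' Iic q) := by
    rw [← Measure.map_apply hU measurableSet_Iic, hκ, Measure.restrict_apply measurableSet_Iic,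
      ← Real.volume_Ioo]
    refine measure_mono fun t ht => ?_
    simp only [mem_Ioo, lt_min_iff] at ht
    exact ⟨ht.2.2.le, ht.1, ht.2.1⟩
  have h2 : κ (U ⁻¹' Iic q) ≤ κ (E ∩ U ⁻¹' Iic q) + κ Eᶜ :=
    (measure_mono fun ω hω => by
      by_cases h : ω ∈ E
      · exact Or.inl ⟨h, hω⟩
      · exact Or.inr h).trans (measure_union_le _ _)
  calc volume.restrict (Ioo a b) (Ioi (a + e) ∩ Iic q)
      ≤ volume (Ioc (a + e) (min b q)) := by
        rw [Measure.restrict_apply (measurableSet_Ioi.inter measurableSet_Iic)]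
        exact measure_mono fun t ht => ⟨ht.1.1, le_min ht.2.2.le ht.1.2⟩
    _ = ENNReal.ofReal (min b q - a) - ENNReal.ofReal e := by
        rw [Real.volume_Ioc, ← ENNReal.ofReal_sub _ he]
        congr 1
        ring
    _ ≤ _ := tsub_le_iff_right.2 (h1.trans (h2.trans (by gcongr)))

end Rearrangement

/-! ### The bounds for `Y₁ - Y₀`. -/

theorem theorem1 {Ω : Type*} [MeasurableSpace Ω] (P : Measure Ω) [IsProbabilityMeasure P]
    (Y₀ Y₁ U : Ω → ℝ) (hY₀ : Measurable Y₀) (hY₁ : Measurable Y₁) (hU : Measurable U)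
    (hUunif : P.map U = volume.restrict (Ioo (0 : ℝ) 1))
    (Q₀ Q₁ : ℝ → ℝ) (hQ₀ : Q₀ = leftQuantile (P.map Y₀)) (hQ₁ : Q₁ = leftQuantile (P.map Y₁))
    (hrank : ∀ᵐ ω ∂P, Y₀ ω = Q₀ (U ω))
    (a b : ℝ) (ha : 0 ≤ a) (hab : a < b) (hb : b ≤ 1) :
    -- the two dominance relations, conditional on `a < U < b`
    SecondOrderDominated (P[|{ω | a < U ω ∧ U ω < b}])
      (fun ω => Q₁ (b - U ω) - Q₀ (U ω)) (fun ω => Y₁ ω - Y₀ ω) ∧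
    SecondOrderDominated (P[|{ω | a < U ω ∧ U ω < b}])
      (fun ω => Y₁ ω - Y₀ ω) (fun ω => Q₁ (1 - b + U ω) - Q₀ (U ω)) ∧
    -- bounds for nondecreasing convex functions
    (∀ f : ℝ → ℝ, Monotone f → ConvexOn ℝ univ f →
      ExtIntegralLE
        (volume.restrict (Ioo a b)) (fun u => f (Q₁ (u - a) - Q₀ u))
        P ({ω | a < U ω ∧ U ω < b}.indicator fun ω => f (Y₁ ω - Y₀ ω)) ∧
      ExtIntegralLE
        P ({ω | a < U ω ∧ U ω < b}.indicator fun ω => f (Y₁ ω - Y₀ ω))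
        (volume.restrict (Ioo a b)) (fun u => f (Q₁ (1 - u + a) - Q₀ u))) ∧
    -- bounds for nonincreasing convex functions
    (∀ g : ℝ → ℝ, Antitone g → ConvexOn ℝ univ g →
      ExtIntegralLE
        (volume.restrict (Ioo a b)) (fun u => g (Q₁ (1 - b + u) - Q₀ u))
        P ({ω | a < U ω ∧ U ω < b}.indicator fun ω => g (Y₁ ω - Y₀ ω)) ∧
      ExtIntegralLE
        P ({ω | a < U ω ∧ U ω < b}.indicator fun ω => g (Y₁ ω - Y₀ ω))
        (volume.restrict (Ioo a b)) (fun u => g (Q₁ (b - u) - Q₀ u))) := by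
  set C : Set Ω := {ω | a < U ω ∧ U ω < b} with hC
  set κ := P.restrict C with hκdef
  set ρ : Measure ℝ := volume.restrict (Ioo a b) with hρ
  have : IsProbabilityMeasure (P.map Y₀) := Measure.isProbabilityMeasure_map hY₀.aemeasurable
  have : IsProbabilityMeasure (P.map Y₁) := Measure.isProbabilityMeasure_map hY₁.aemeasurable
  have hsub : ∀ {u : ℝ}, u ∈ Ioo a b → u ∈ Ioo (0 : ℝ) 1 := fun hu =>
    ⟨ha.trans_lt hu.1, hu.2.trans_le hb⟩
  have hCm : MeasurableSet C := hU measurableSet_Ioo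
  have hκ : κ.map U = ρ := by
    have h := Measure.restrict_map (μ := P) hU (measurableSet_Ioo (a := a) (b := b))
    rw [hUunif, Measure.restrict_restrict measurableSet_Ioo,
      inter_eq_left.2 fun u hu => hsub hu] at h
    exact h.symm
  have hmass : κ univ = ρ univ := by
    rw [← hκ, Measure.map_apply hU MeasurableSet.univ, preimage_univ]
  have hPC : P C ≠ 0 := by
    have : P C = ENNReal.ofReal (b - a) := by
      rw [← Measure.restrict_apply_univ (μ := P) C, ← hκdef, hmass, hρ,
        Measure.restrict_apply_univ, Real.volume_Ioo]
    rw [this]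
    simpa using hab
  have hmemκ : ∀ᵐ ω ∂κ, U ω ∈ Ioo a b := ae_restrict_mem hCm
  have hmemρ : ∀ᵐ u ∂ρ, u ∈ Ioo a b := ae_restrict_mem measurableSet_Ioo
  have hrank' : ∀ᵐ ω ∂κ, Y₀ ω = Q₀ (U ω) := ae_restrict_of_ae hrank
  have h₀le : ∀ {u s : ℝ}, u ∈ Ioo a b → (Q₀ u ≤ s ↔ u ≤ cdf (P.map Y₀) s) := fun hu => by
    rw [hQ₀]; exact leftQuantile_le_iff _ (hsub hu)
  have h₁le : ∀ {p t : ℝ}, p ∈ Ioo (0 : ℝ) 1 → (Q₁ p ≤ t ↔ p ≤ cdf (P.map Y₁) t) := fun hp => by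
    rw [hQ₁]; exact leftQuantile_le_iff _ hp
  have hmono₀ : MonotoneOn Q₀ (Ioo a b) := by
    rw [hQ₀]; exact (monotoneOn_leftQuantile _).mono fun u hu => hsub hu
  have hmono₁ : MonotoneOn Q₁ (Ioo 0 1) := by
    rw [hQ₁]; exact monotoneOn_leftQuantile _
  have hI₁ : ∀ {u : ℝ}, u ∈ Ioo a b → b - u ∈ Ioo (0 : ℝ) 1 := fun hu =>
    ⟨by linarith [hu.2], by linarith [hu.1]⟩
  have hI₂ : ∀ {u : ℝ}, u ∈ Ioo a b → 1 - b + u ∈ Ioo (0 : ℝ) 1 := fun hu =>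
    ⟨by linarith [hu.1], by linarith [hu.2]⟩
  have hI₃ : ∀ {u : ℝ}, u ∈ Ioo a b → u - a ∈ Ioo (0 : ℝ) 1 := fun hu =>
    ⟨by linarith [hu.1], by linarith [hu.2]⟩
  have hI₄ : ∀ {u : ℝ}, u ∈ Ioo a b → 1 - u + a ∈ Ioo (0 : ℝ) 1 := fun hu =>
    ⟨by linarith [hu.2], by linarith [hu.1]⟩
  have hq₀ : AEMeasurable Q₀ ρ := aemeasurable_restrict_of_monotoneOn measurableSet_Ioo hmono₀
  have hq₁ : AEMeasurable (fun u => Q₁ (b - u)) ρ :=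
    aemeasurable_restrict_of_antitoneOn measurableSet_Ioo fun u hu v hv huv =>
      hmono₁ (hI₁ hv) (hI₁ hu) (by linarith)
  have hq₂ : AEMeasurable (fun u => Q₁ (1 - b + u)) ρ :=
    aemeasurable_restrict_of_monotoneOn measurableSet_Ioo fun u hu v hv huv =>
      hmono₁ (hI₂ hu) (hI₂ hv) (by linarith)
  have hq₃ : AEMeasurable (fun u => Q₁ (u - a)) ρ :=
    aemeasurable_restrict_of_monotoneOn measurableSet_Ioo fun u hu v hv huv =>
      hmono₁ (hI₃ hu) (hI₃ hv) (by linarith)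
  have hq₄ : AEMeasurable (fun u => Q₁ (1 - u + a)) ρ :=
    aemeasurable_restrict_of_antitoneOn measurableSet_Ioo fun u hu v hv huv =>
      hmono₁ (hI₄ hv) (hI₄ hu) (by linarith)
  have hy₀ : AEMeasurable Y₀ κ := hY₀.aemeasurable
  have hy₁ : AEMeasurable Y₁ κ := hY₁.aemeasurable
  -- The only link between `κ` and the law of `Y₁`: its dependence on `U` is unrestricted.
  have hκle : ∀ E, κ E ≤ P E := Measure.restrict_apply_le C
  have hcdf : ∀ t, P (Y₁ ⁻¹' Iic t) = ENNReal.ofReal (cdf (P.map Y₁) t) := fun t => by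
    rw [ofReal_cdf, Measure.map_apply hY₁ measurableSet_Iic]
  have hccdf : ∀ t, P (Y₁ ⁻¹' Iic t)ᶜ = ENNReal.ofReal (1 - cdf (P.map Y₁) t) := fun t => by
    rw [prob_compl_eq_one_sub (hY₁ measurableSet_Iic), hcdf,
      ENNReal.ofReal_sub _ (cdf_nonneg _ _), ENNReal.ofReal_one]
  have hgt : ∀ E s, κ (E ∩ {ω | s < Y₀ ω}) = κ (E ∩ U ⁻¹' Ioi (cdf (P.map Y₀) s)) :=
    fun E s => measure_congr <| by
      filter_upwards [hmemκ, hrank'] with ω hω hr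
      refine propext (and_congr_right fun _ => ?_)
      change s < Y₀ ω ↔ cdf (P.map Y₀) s < U ω
      rw [hr, ← not_le, h₀le hω, not_le]
  have hle : ∀ E s, κ (E ∩ {ω | Y₀ ω ≤ s}) = κ (E ∩ U ⁻¹' Iic (cdf (P.map Y₀) s)) :=
    fun E s => measure_congr <| by
      filter_upwards [hmemκ, hrank'] with ω hω hr
      refine propext (and_congr_right fun _ => ?_)
      change Y₀ ω ≤ s ↔ U ω ≤ cdf (P.map Y₀) s
      rw [hr, h₀le hω]
  have lintegral_put_upper : ∀ x, ∫⁻ ω, ENNReal.ofReal (x - (Y₁ ω - Y₀ ω)) ∂κ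
      ≤ ∫⁻ u, ENNReal.ofReal (x - (Q₁ (b - u) - Q₀ u)) ∂ρ := fun x => by
    rw [lintegral_ofReal_sub_sub hy₁ hy₀, lintegral_ofReal_sub_sub hq₁ hq₀]
    refine lintegral_mono fun t => ?_
    refine (hgt (Y₁ ⁻¹' Iic t) (t - x)).trans_le <|
      (measure_inter_preimage_Ioi_le hU hκ ((hκle _).trans (hcdf t).le) _).trans_eq <|
      measure_congr ?_
    filter_upwards [hmemρ] with u hu
    refine propext (and_congr ?_ ?_)
    -- The top interval of ranks of length `F₁(t)` is the sublevel set of `Q₁ (b - u)`.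
    · change b - cdf (P.map Y₁) t ≤ u ↔ Q₁ (b - u) ≤ t
      rw [h₁le (hI₁ hu), sub_le_comm]
    · change cdf (P.map Y₀) (t - x) < u ↔ t - x < Q₀ u
      rw [← not_le, ← h₀le hu, not_le]
  have lintegral_put_lower : ∀ x, ∫⁻ u, ENNReal.ofReal (x - (Q₁ (1 - b + u) - Q₀ u)) ∂ρ
      ≤ ∫⁻ ω, ENNReal.ofReal (x - (Y₁ ω - Y₀ ω)) ∂κ := fun x => by
    rw [lintegral_ofReal_sub_sub hy₁ hy₀, lintegral_ofReal_sub_sub hq₂ hq₀]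
    refine lintegral_mono fun t => ?_
    refine (measure_congr ?_).trans_le <|
      (le_measure_inter_preimage_Ioi hU hκ (sub_nonneg.2 (cdf_le_one _ _))
        ((hκle _).trans (hccdf t).le) _).trans_eq (hgt (Y₁ ⁻¹' Iic t) (t - x)).symm
    filter_upwards [hmemρ] with u hu
    refine propext (and_congr ?_ ?_)
    · change Q₁ (1 - b + u) ≤ t ↔ u ≤ b - (1 - cdf (P.map Y₁) t)
      rw [h₁le (hI₂ hu)]
      constructor <;> intro h <;> linarith
    · change t - x < Q₀ u ↔ cdf (P.map Y₀) (t - x) < u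
      rw [← not_le, h₀le hu, not_le]
  -- A call on `Y₁ - Y₀` is a put on `Y₀ - Y₁`, so the same Tonelli formula applies with the roles
  -- exchanged.
  have hflip : ∀ x y z : ℝ, y - z - x = -x - (z - y) := fun x y z => by ring
  have lintegral_call_upper : ∀ x, ∫⁻ ω, ENNReal.ofReal (Y₁ ω - Y₀ ω - x) ∂κ
      ≤ ∫⁻ u, ENNReal.ofReal (Q₁ (1 - u + a) - Q₀ u - x) ∂ρ := fun x => by
    simp_rw [hflip x]
    rw [lintegral_ofReal_sub_sub hy₀ hy₁, lintegral_ofReal_sub_sub hq₀ hq₄]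
    refine lintegral_mono fun t => ?_
    have hset : {ω | Y₀ ω ≤ t ∧ t - -x < Y₁ ω} = (Y₁ ⁻¹' Iic (t - -x))ᶜ ∩ {ω | Y₀ ω ≤ t} := by
      ext ω; simp [and_comm]
    simp only [hset]
    refine (hle _ t).trans_le <|
      (measure_inter_preimage_Iic_le hU hκ ((hκle _).trans (hccdf (t - -x)).le) _).trans_eq <|
      measure_congr ?_
    filter_upwards [hmemρ] with u hu
    refine propext (and_comm.trans (and_congr ?_ ?_))
    · change u ≤ cdf (P.map Y₀) t ↔ Q₀ u ≤ t
      rw [h₀le hu]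
    · change u < a + (1 - cdf (P.map Y₁) (t - -x)) ↔ t - -x < Q₁ (1 - u + a)
      rw [← not_le (b := t - -x), h₁le (hI₄ hu), not_le]
      constructor <;> intro h <;> linarith
  have lintegral_call_lower : ∀ x, ∫⁻ u, ENNReal.ofReal (Q₁ (u - a) - Q₀ u - x) ∂ρ
      ≤ ∫⁻ ω, ENNReal.ofReal (Y₁ ω - Y₀ ω - x) ∂κ := fun x => by
    simp_rw [hflip x]
    rw [lintegral_ofReal_sub_sub hy₀ hy₁, lintegral_ofReal_sub_sub hq₀ hq₃]
    refine lintegral_mono fun t => ?_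
    have hset : {ω | Y₀ ω ≤ t ∧ t - -x < Y₁ ω} = (Y₁ ⁻¹' Iic (t - -x))ᶜ ∩ {ω | Y₀ ω ≤ t} := by
      ext ω; simp [and_comm]
    simp only [hset]
    refine (measure_congr ?_).trans_le <|
      (le_measure_inter_preimage_Iic hU hκ (cdf_nonneg (P.map Y₁) (t - -x))
        ((hκle _).trans (by rw [compl_compl, hcdf])) _).trans_eq (hle _ t).symm
    filter_upwards [hmemρ] with u hu
    refine propext (and_comm.trans (and_congr ?_ ?_))
    · change t - -x < Q₁ (u - a) ↔ a + cdf (P.map Y₁) (t - -x) < u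
      rw [← not_le, h₁le (hI₃ hu), not_le, lt_sub_iff_add_lt']
    · change Q₀ u ≤ t ↔ u ≤ cdf (P.map Y₀) t
      rw [h₀le hu]
  -- Under `κ` the rank `U` has Lebesgue law on `(a, b)`: this moves the comparison functions from
  -- `u` to `U ω`.
  have hpull : ∀ {A : ℝ → ℝ}, AEMeasurable A ρ → ∀ x, AEMeasurable (fun ω => A (U ω)) κ ∧
      ∫⁻ ω, ENNReal.ofReal (x - A (U ω)) ∂κ = ∫⁻ u, ENNReal.ofReal (x - A u) ∂ρ :=
    fun {A} hA x => by
      rw [← hκ] at hA ⊢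
      exact ⟨hA.comp_measurable hU,
        (lintegral_map' (hA.const_sub x).ennreal_ofReal hU.aemeasurable).symm⟩
  have hd := hy₁.sub hy₀
  have hinv : (P C)⁻¹ ≠ ∞ := ENNReal.inv_ne_top.2 hPC
  refine ⟨?_, ?_, fun f hf hfc => ⟨?_, ?_⟩, fun g hg hgc => ⟨?_, ?_⟩⟩
  · refine SecondOrderDominated.of_stopLoss (hpull (hq₁.sub hq₀) 0).1 hd hinv fun x => ?_
    exact (lintegral_put_upper x).trans_eq (hpull (hq₁.sub hq₀) x).2.symm
  · refine SecondOrderDominated.of_stopLoss hd (hpull (hq₂.sub hq₀) 0).1 hinv fun x => ?_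
    exact (hpull (hq₂.sub hq₀) x).2.trans_le (lintegral_put_lower x)
  all_goals
    simp only [ExtIntegralLE, hasExtIntegral_indicator hCm, extIntegral_indicator hCm]
  · exact ExtIntegralLE.of_stopLoss (hq₃.sub hq₀) hd hmass.symm lintegral_call_lower hf hfc
  · exact ExtIntegralLE.of_stopLoss hd (hq₄.sub hq₀) hmass lintegral_call_upper hf hfc
  · exact ExtIntegralLE.of_stopLoss_antitone (hq₂.sub hq₀) hd hmass.symm
      lintegral_put_lower hg hgc
  · exact ExtIntegralLE.of_stopLoss_antitone hd (hq₁.sub hq₀) hmass lintegral_put_upper hg hgc
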